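/- Let $U,K\ge 0$, $n\ge 1$, and consider $U$ tags with coordinate vector $\mathbf p_{\mathcal U}\in\mathbb R^{nU}$ and $K$ anchors with known coordinate vector $\mathbf p_{\mathcal K}\in\mathbb R^{nK}$ in $n$-dimensional Euclidean space (in particular $n=2$ or $n=3$); put $\mathbf p=\mathrm{col}(\mathbf p_{\mathcal U},\mathbf p_{\mathcal K})$, $\mathbf p_{ij}=\mathbf p_i-\mathbf p_j$, $d_{ij}=\|\mathbf p_{ij}\|$. Let $\mathcal G$ be an undirected simple graph on the nodes, with neighborhoods $\mathcal N_i$. The ranging pairs are the edges of $\mathcal G$ that contain at least one tag; each of them provides a measurement $\tilde d_{ij}$, and we consider one of the two models $$\tilde d_{ij}=d_{ij}+\nu_{ij}\quad(\kappa:=1)\qquad\text{or}\qquad \tilde d_{ij}=d_{ij}\,e^{\nu_{ij}}\quad(\kappa:=2),$$ with independent $\nu_{ij}\sim\mathcal N(0,\sigma^2)$, $\sigma>0$. Let $\tilde{\mathbf d}$ be the vector of all measurements and $f(\tilde{\mathbf d};\mathbf p)$ its density. Let $\mathbf F_{\mathcal U}(\mathbf p)$ be the $nU\times nU$ block, corresponding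 to the tag coordinates, of the Fisher information matrix $\mathbf F(\mathbf p)=-\mathbb E\left[\frac{\partial^2\ln f(\tilde{\mathbf d};\mathbf p)}{\partial\mathbf p\,\partial\mathbf p^\top}\right]$. Let $\mathbf f_c:\mathbb R^{nU}\to\mathbb R^C$ be a known constraint function, $\mathcal C_{\mathcal U}=\{\mathbf q\in\mathbb R^{nU}:\mathbf f_c(\mathbf q)=\mathbf 0\}$, and let the true tag positions satisfy $\mathbf p_{\mathcal U}\in\mathcal C_{\mathcal U}$. Assume that $d_{ij}\neq 0$ at $\mathbf p$ for every ranging pair, that $\mathbf f_c$ is differentiable at $\mathbf p_{\mathcal U}$, and that $\mathbf p_{\mathcal U}$ is a regular point of the constraints in the sense that $\ker\frac{\partial\mathbf f_c}{\partial\mathbf p_{\mathcal U}}(\mathbf p_{\mathcal U})$ is spanned by tangent vectors of $\mathcal C_{\mathcal U}$ at $\mathbf p_{\mathcal U}$, i.e. by limits of $t_k(\mathbf q_k-\mathbf p_{\mathcal U})$ with $t_k\in\mathbb R$, $\mathbf q_k\in\mathcal C_{\mathcal U}$, $\mathbf q_k\to\mathbf p_{\mathcal U}$ (this holds, for example, if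 $\mathbf f_c$ is $C^1$ and its Jacobian has constant rank near $\mathbf p_{\mathcal U}$). Let $\mathbf A_{\mathcal U}$ be a matrix whose columns span $\ker\frac{\partial\mathbf f_c}{\partial\mathbf p_{\mathcal U}}(\mathbf p_{\mathcal U})$. Let $\hat{\mathbf p}_{\mathcal U}$ be an estimator of the tag positions, i.e. a function of $\tilde{\mathbf d}$ (which may depend on the known $\mathbf p_{\mathcal K}$ and $\mathbf f_c$), with finite second moments at $\mathbf p$, and unbiased in the sense that $\mathbb E[\hat{\mathbf p}_{\mathcal U}]=\mathbf q$ when the tag positions are $\mathbf q$ (and the anchor positions are $\mathbf p_{\mathcal K}$), for all feasible $\mathbf q\in\mathcal C_{\mathcal U}$ (it is enough: for all those in some neighborhood of $\mathbf p_{\mathcal U}$). Then, at $\mathbf p$, $$\mathsf{cov}[\hat{\mathbf p}_{\mathcal U}]\succeq \mathbf A_{\mathcal U}\left[\mathbf A_{\mathcal U}^\top\mathbf F_{\mathcal U}(\mathbf p)\mathbf A_{\mathcal U}\right]^{\dagger}\mathbf A_{\mathcal U}^\top ,$$ where $\dagger$ is the Moore--Penrose pseudo-inverse and $\mathbf X\succeq\mathbf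 Y$ means that $\mathbf X-\mathbf Y$ is positive semidefinite. Moreover $\mathbf F_{\mathcal U}(\mathbf p)$ is the tag block of the matrix with $n\times n$ blocks $$\mathbf F_{ij}=-\frac{1}{d_{ij}^{2\kappa}\sigma^2}\,\mathbf p_{ij}\mathbf p_{ij}^\top\ \text{ if } j\in\mathcal N_i,\qquad \mathbf F_{ij}=\mathbf 0\ \text{ if } j\ne i,\ j\notin\mathcal N_i,\qquad \mathbf F_{ii}=-\sum_{j\neq i}\mathbf F_{ij}.$$ -/

import Mathlib

open MeasureTheory ProbabilityTheory
open scoped NNReal ENNReal Matrix Topology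

/-! ### Moore-Penrose pseudo-inverse of a real matrix -/

/-- `X` satisfies the four Penrose equations for `M`. -/
structure IsMoorePenrose {m n : Type*} [Fintype m] [Fintype n]
    (M : Matrix m n ℝ) (X : Matrix n m ℝ) : Prop where
  mul_mul_self : M * X * M = M
  mul_mul_inv : X * M * X = X
  symm_left : (M * X)ᵀ = M * X
  symm_right : (X * M)ᵀ = X * M

theorem IsMoorePenrose.unique {m n : Type*} [Fintype m] [Fintype n]
    {M : Matrix m n ℝ} {X Y : Matrix n m ℝ}
    (hX : IsMoorePenrose M X) (hY : IsMoorePenrose M Y) : X = Y := by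
  have h1 : M * X = M * Y := by
    calc M * X = (M * X)ᵀ := hX.symm_left.symm
      _ = ((M * Y) * (M * X))ᵀ := by
          rw [← Matrix.mul_assoc (M * Y) M X, hY.mul_mul_self]
      _ = (M * X) * (M * Y) := by rw [Matrix.transpose_mul, hX.symm_left, hY.symm_left]
      _ = M * Y := by rw [← Matrix.mul_assoc (M * X) M Y, hX.mul_mul_self]
  have h2 : X * M = Y * M := by
    calc X * M = (X * M)ᵀ := hX.symm_right.symm
      _ = ((X * M) * (Y * M))ᵀ := by
          rw [Matrix.mul_assoc X M (Y * M), ← Matrix.mul_assoc M Y M, hY.mul_mul_self]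
      _ = (Y * M) * (X * M) := by rw [Matrix.transpose_mul, hX.symm_right, hY.symm_right]
      _ = Y * M := by rw [Matrix.mul_assoc Y M (X * M), ← Matrix.mul_assoc M X M, hX.mul_mul_self]
  calc X = X * M * X := hX.mul_mul_inv.symm
    _ = Y * (M * X) := by rw [h2, Matrix.mul_assoc]
    _ = Y * M * Y := by rw [h1, Matrix.mul_assoc]
    _ = Y := hY.mul_mul_inv

theorem exists_isMoorePenrose {m n : Type*} [Fintype m] [Fintype n]
    (M : Matrix m n ℝ) : ∃ X : Matrix n m ℝ, IsMoorePenrose M X := by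
  classical
  obtain ⟨G, hG, hSGS, hGSG, hGS⟩ : ∃ G : Matrix n n ℝ, Gᵀ = G ∧
      (Mᵀ * M) * G * (Mᵀ * M) = Mᵀ * M ∧ G * (Mᵀ * M) * G = G ∧
      (G * (Mᵀ * M))ᵀ = G * (Mᵀ * M) := by
    have hS : (Mᵀ * M).IsHermitian := by
      simpa using Matrix.isHermitian_conjTranspose_mul_self M
    set V : Matrix n n ℝ := (hS.eigenvectorUnitary : Matrix n n ℝ) with hV
    have hVV : Vᵀ * V = 1 := by
      have := Matrix.mem_unitaryGroup_iff'.mp hS.eigenvectorUnitary.2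
      simpa [Matrix.star_eq_conjTranspose] using this
    have hsp : Mᵀ * M = V * Matrix.diagonal hS.eigenvalues * Vᵀ := by
      have := hS.spectral_theorem
      rw [Unitary.conjStarAlgAut_apply] at this
      simpa [Matrix.star_eq_conjTranspose, Function.comp_def] using this
    set D := Matrix.diagonal hS.eigenvalues with hD
    set E := Matrix.diagonal (fun i => (hS.eigenvalues i)⁻¹) with hE
    have cancel : ∀ B C : Matrix n n ℝ, (V * B * Vᵀ) * (V * C * Vᵀ) = V * (B * C) * Vᵀ := by
      intro B C
      calc (V * B * Vᵀ) * (V * C * Vᵀ) = V * B * (Vᵀ * V) * C * Vᵀ := by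
            simp only [Matrix.mul_assoc]
        _ = V * (B * C) * Vᵀ := by rw [hVV, Matrix.mul_one, Matrix.mul_assoc V B C]
    refine ⟨V * E * Vᵀ, ?_, ?_, ?_, ?_⟩
    · simp [hE, Matrix.transpose_mul, Matrix.mul_assoc]
    · rw [hsp, cancel, cancel]
      congr 2
      simp only [hD, hE, Matrix.diagonal_mul_diagonal]
      congr 1; ext i; exact mul_inv_mul_cancel _
    · rw [hsp, cancel, cancel]
      congr 2
      simp only [hD, hE, Matrix.diagonal_mul_diagonal]
      congr 1; ext i
      by_cases h : hS.eigenvalues i = 0 <;> simp [h]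
    · rw [hsp, cancel]
      simp [hD, hE, Matrix.transpose_mul, Matrix.mul_assoc]
  refine ⟨G * Mᵀ, ?_, ?_, ?_, ?_⟩
  · have key : M * (1 - G * (Mᵀ * M)) = 0 := by
      rw [← Matrix.conjTranspose_mul_self_eq_zero, Matrix.conjTranspose_eq_transpose_of_trivial,
        Matrix.transpose_mul, Matrix.mul_assoc, ← Matrix.mul_assoc Mᵀ M, Matrix.mul_sub,
        Matrix.mul_one, ← Matrix.mul_assoc (Mᵀ * M), hSGS, sub_self, Matrix.mul_zero]
    rw [Matrix.mul_sub, Matrix.mul_one, sub_eq_zero] at key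
    rw [Matrix.mul_assoc, Matrix.mul_assoc]
    exact key.symm
  · calc G * Mᵀ * M * (G * Mᵀ) = (G * (Mᵀ * M) * G) * Mᵀ := by simp only [Matrix.mul_assoc]
      _ = G * Mᵀ := by rw [hGSG]
  · simp [Matrix.transpose_mul, hG, Matrix.mul_assoc]
  · rw [Matrix.mul_assoc]; exact hGS

/-- The Moore-Penrose pseudo-inverse `M†` of a real matrix. -/
noncomputable def pseudoInverse {m n : Type*} [Fintype m] [Fintype n]
    (M : Matrix m n ℝ) : Matrix n m ℝ :=
  (exists_isMoorePenrose M).choose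

theorem pseudoInverse_spec {m n : Type*} [Fintype m] [Fintype n] (M : Matrix m n ℝ) :
    IsMoorePenrose M (pseudoInverse M) :=
  (exists_isMoorePenrose M).choose_spec

/-! ### Jacobian, Hessian, Fisher information, covariance matrix -/

/-- The Jacobian matrix `∂f/∂x`, with entries `∂fᵢ/∂xⱼ`. -/
noncomputable def jacobianMatrix {ι κ : Type*} [Fintype ι] [DecidableEq ι] [Fintype κ]
    (f : (ι → ℝ) → (κ → ℝ)) (x : ι → ℝ) : Matrix κ ι ℝ :=
  Matrix.of fun i j => fderiv ℝ f x (Pi.single j 1) i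

/-- The Hessian matrix `∂²g/∂x∂xᵀ`, with entries `∂²g/∂xᵢ∂xⱼ`. -/
noncomputable def hessianMatrix {ι : Type*} [Fintype ι] [DecidableEq ι]
    (g : (ι → ℝ) → ℝ) (x : ι → ℝ) : Matrix ι ι ℝ :=
  Matrix.of fun i j => fderiv ℝ (fun z => fderiv ℝ g z (Pi.single j 1)) x (Pi.single i 1)

/-- The Fisher information matrix `-E_y[∂² ln f(y; x) / ∂x∂xᵀ]` at the parameter `x`, where `f` is
the density of the observation `y` and `μ` is the law of `y` for the parameter `x`. -/
noncomputable def fisherInformation {ι Y : Type*} [Fintype ι] [DecidableEq ι] [MeasurableSpace Y]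
    (f : Y → (ι → ℝ) → ℝ) (μ : Measure Y) (x : ι → ℝ) : Matrix ι ι ℝ :=
  Matrix.of fun i j => -∫ y, hessianMatrix (fun z => Real.log (f y z)) x i j ∂μ

/-- The covariance matrix of a random vector. -/
noncomputable def covMatrix {ι Y : Type*} [MeasurableSpace Y]
    (X : Y → ι → ℝ) (μ : Measure Y) : Matrix ι ι ℝ :=
  Matrix.of fun i j => cov[fun y => X y i, fun y => X y j; μ]

/-! ### Ranging networks

The nodes are `U ⊕ K`: tags `Sum.inl u` and anchors `Sum.inr k`. A configuration of the nodes in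
`n`-dimensional Euclidean space is its vector of coordinates, indexed by `(U ⊕ K) × Fin n`. -/

namespace RangingNetwork

variable {U K : Type*} {n : ℕ}

/-- The configuration `col(p_U, p_K)`. -/
def joinPos (pU : U × Fin n → ℝ) (pK : K × Fin n → ℝ) : (U ⊕ K) × Fin n → ℝ :=
  fun ia => Sum.elim (fun u => pU (u, ia.2)) (fun k => pK (k, ia.2)) ia.1

/-- The relative position `p_i - p_j` of two nodes, in Euclidean space. -/
def relPos (p : (U ⊕ K) × Fin n → ℝ) (i j : U ⊕ K) : EuclideanSpace ℝ (Fin n) :=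
  WithLp.toLp 2 fun a => p (i, a) - p (j, a)

/-- The distance between the two endpoints of a pair of nodes. -/
noncomputable def pairDist (p : (U ⊕ K) × Fin n → ℝ) (e : Sym2 (U ⊕ K)) : ℝ :=
  Sym2.lift ⟨fun i j => ‖relPos p i j‖, fun i j => by
    change ‖relPos p i j‖ = ‖relPos p j i‖
    rw [← norm_neg]; congr 1; ext a; simp [relPos]⟩ e

/-- The pairs of nodes that measure their distance: the edges of the ranging graph that contain at
least one tag. (Edges between anchors carry no measurement.) -/
abbrev RangingPair (G : SimpleGraph (U ⊕ K)) : Type _ :=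
  {e : Sym2 (U ⊕ K) // e ∈ G.edgeSet ∧ ∃ u : U, Sum.inl u ∈ e}

noncomputable instance [Finite U] [Finite K] (G : SimpleGraph (U ⊕ K)) :
    Fintype (RangingPair G) := by
  classical
  haveI := Fintype.ofFinite U
  haveI := Fintype.ofFinite K
  exact Fintype.ofFinite _

/-- The two measurement models: `d + ν` and `d * exp ν`, with `ν` centered Gaussian. -/
inductive NoiseModel
  | additive
  | multiplicative

namespace NoiseModel

/-- The measurement of a distance `d` when the noise has the value `ν`. -/
noncomputable def observe : NoiseModel → ℝ → ℝ → ℝ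
  | additive, d, ν => d + ν
  | multiplicative, d, ν => d * Real.exp ν

/-- The exponent `κ`: `1` for additive noise and `2` for multiplicative noise. -/
def kappa : NoiseModel → ℕ
  | additive => 1
  | multiplicative => 2

/-- The density of the measurement of a distance `d > 0`: the normal density `N(d, σ²)`, resp. the
log-normal density with parameters `ln d` and `σ²`. -/
noncomputable def pdf : NoiseModel → ℝ≥0 → ℝ → ℝ → ℝ
  | additive, σ, d, y => gaussianPDFReal d (σ ^ 2) y
  | multiplicative, σ, d, y =>
      if 0 < y then y⁻¹ * gaussianPDFReal (Real.log d) (σ ^ 2) (Real.log y) else 0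

/-- The law of one measurement of a distance `d`, with `N(0, σ²)` noise. -/
noncomputable def law (model : NoiseModel) (σ : ℝ≥0) (d : ℝ) : Measure ℝ :=
  (gaussianReal 0 (σ ^ 2)).map (model.observe d)

variable {σ : ℝ≥0} {d : ℝ}

theorem pdf_nonneg (model : NoiseModel) (y : ℝ) : 0 ≤ model.pdf σ d y := by
  cases model with
  | additive => exact gaussianPDFReal_nonneg _ _ _
  | multiplicative =>
    simp only [pdf]
    split_ifs with h
    · exact mul_nonneg (inv_nonneg.mpr h.le) (gaussianPDFReal_nonneg _ _ _)
    · exact le_rfl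

theorem measurable_pdf (model : NoiseModel) : Measurable (model.pdf σ d) := by
  cases model with
  | additive => exact measurable_gaussianPDFReal _ _
  | multiplicative =>
    refine Measurable.ite measurableSet_Ioi ?_ measurable_const
    exact measurable_inv.mul ((measurable_gaussianPDFReal _ _).comp Real.measurable_log)

theorem measurable_observe (model : NoiseModel) : Measurable (model.observe d) := by
  cases model with
  | additive => exact measurable_const_add d
  | multiplicative => exact Real.measurable_exp.const_mul d

instance (model : NoiseModel) : IsProbabilityMeasure (model.law σ d) :=
  Measure.isProbabilityMeasure_map model.measurable_observe.aemeasurable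

/-- `pdf` is indeed the density of `law`. -/
theorem law_eq_withDensity (model : NoiseModel) (hσ : 0 < σ) (hd : 0 < d) :
    model.law σ d = volume.withDensity fun y => ENNReal.ofReal (model.pdf σ d y) := by
  have hv : σ ^ 2 ≠ 0 := (pow_pos hσ 2).ne'
  cases model with
  | additive =>
    change (gaussianReal 0 (σ ^ 2)).map (fun ν => d + ν) = _
    rw [gaussianReal_map_const_add, zero_add, gaussianReal_of_var_ne_zero _ hv]
    rfl
  | multiplicative =>
    have hinj : Function.Injective fun x : ℝ => d * Real.exp x := fun a b h =>
      Real.exp_injective (mul_left_cancel₀ hd.ne' h)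
    ext s hs
    have hm : Measurable fun x : ℝ => d * Real.exp x := Real.measurable_exp.const_mul d
    change (gaussianReal 0 (σ ^ 2)).map (fun ν => d * Real.exp ν) s = _
    rw [Measure.map_apply hm hs, gaussianReal_apply _ hv, withDensity_apply _ hs]
    have himg : (fun x : ℝ => d * Real.exp x) '' ((fun x : ℝ => d * Real.exp x) ⁻¹' s)
        = s ∩ Set.Ioi 0 := by
      rw [Set.image_preimage_eq_inter_range]
      congr 1
      ext y
      constructor
      · rintro ⟨x, rfl⟩
        exact mul_pos hd (Real.exp_pos x)
      · intro hy
        refine ⟨Real.log (y / d), ?_⟩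
        change d * Real.exp (Real.log (y / d)) = y
        rw [Real.exp_log (div_pos hy hd), mul_div_cancel₀ _ hd.ne']
    have hsplit : ∫⁻ y in s, ENNReal.ofReal (multiplicative.pdf σ d y)
        = ∫⁻ y in s ∩ Set.Ioi 0, ENNReal.ofReal (multiplicative.pdf σ d y) := by
      rw [← lintegral_indicator hs, ← lintegral_indicator (hs.inter measurableSet_Ioi)]
      congr 1
      ext y
      by_cases h1 : y ∈ s <;> by_cases h2 : 0 < y <;> simp [Set.indicator, h1, h2, pdf]
    rw [hsplit, ← himg, lintegral_image_eq_lintegral_abs_deriv_mul (hm hs)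
      (fun x _ => ((Real.hasDerivAt_exp x).const_mul d).hasDerivWithinAt) hinj.injOn]
    refine lintegral_congr fun x => ?_
    have hpos : 0 < d * Real.exp x := mul_pos hd (Real.exp_pos x)
    rw [← ENNReal.ofReal_mul (abs_nonneg _), gaussianPDF]
    congr 1
    simp only [pdf, if_pos hpos, abs_of_pos hpos]
    rw [Real.log_mul hd.ne' (Real.exp_pos x).ne', Real.log_exp, ← mul_assoc,
      mul_inv_cancel₀ hpos.ne', one_mul]
    simp [gaussianPDFReal]

end NoiseModel

variable [Fintype U] [Fintype K]

/-- The joint law of all range measurements in the configuration `p`; the measurements of distinct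
pairs are independent. -/
noncomputable def rangeLaw (model : NoiseModel) (σ : ℝ≥0) (G : SimpleGraph (U ⊕ K))
    (p : (U ⊕ K) × Fin n → ℝ) : Measure (RangingPair G → ℝ) :=
  Measure.pi fun e => model.law σ (pairDist p e)

/-- The joint density of all range measurements in the configuration `p`. -/
noncomputable def rangePDF (model : NoiseModel) (σ : ℝ≥0) (G : SimpleGraph (U ⊕ K))
    (y : RangingPair G → ℝ) (p : (U ⊕ K) × Fin n → ℝ) : ℝ :=
  ∏ e : RangingPair G, model.pdf σ (pairDist p e) (y e)

/-- `rangePDF` is indeed the density of `rangeLaw`. -/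
theorem rangeLaw_eq_withDensity (model : NoiseModel) {σ : ℝ≥0} (hσ : 0 < σ)
    (G : SimpleGraph (U ⊕ K)) (p : (U ⊕ K) × Fin n → ℝ)
    (hp : ∀ e : RangingPair G, 0 < pairDist p e) :
    rangeLaw model σ G p = volume.withDensity fun y => ENNReal.ofReal (rangePDF model σ G y p) := by
  have hint : ∀ e : RangingPair G, Integrable (model.pdf σ (pairDist p e)) := by
    intro e
    refine ⟨model.measurable_pdf.aestronglyMeasurable, ?_⟩
    rw [hasFiniteIntegral_iff_ofReal (Filter.Eventually.of_forall model.pdf_nonneg),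
      ← setLIntegral_univ, ← withDensity_apply _ MeasurableSet.univ,
      ← model.law_eq_withDensity hσ (hp e)]
    exact measure_lt_top _ _
  refine Measure.pi_eq fun s hs => ?_
  rw [withDensity_apply _ (MeasurableSet.univ_pi hs), volume_pi, Measure.restrict_pi_pi]
  have h1 : Integrable (fun y : RangingPair G → ℝ => rangePDF model σ G y p)
      (Measure.pi fun e => (volume : Measure ℝ).restrict (s e)) :=
    Integrable.fintype_prod fun e => (hint e).restrict
  rw [← ofReal_integral_eq_lintegral_ofReal h1
    (Filter.Eventually.of_forall fun y => Finset.prod_nonneg fun e _ => model.pdf_nonneg _)]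
  simp only [rangePDF]
  rw [integral_fintype_prod_eq_prod (f := fun e : RangingPair G => model.pdf σ (pairDist p e)),
    ENNReal.ofReal_prod_of_nonneg fun e _ => integral_nonneg model.pdf_nonneg]
  refine Finset.prod_congr rfl fun e _ => ?_
  rw [model.law_eq_withDensity hσ (hp e), withDensity_apply _ (hs e),
    ofReal_integral_eq_lintegral_ofReal (hint e).restrict
      (Filter.Eventually.of_forall model.pdf_nonneg)]

/-- The Fisher information matrix of the range measurements, for all node coordinates. -/
noncomputable def networkFIM [DecidableEq U] [DecidableEq K] (model : NoiseModel) (σ : ℝ≥0)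
    (G : SimpleGraph (U ⊕ K)) (p : (U ⊕ K) × Fin n → ℝ) :
    Matrix ((U ⊕ K) × Fin n) ((U ⊕ K) × Fin n) ℝ :=
  fisherInformation (rangePDF model σ G) (rangeLaw model σ G p) p

open Classical in
/-- The off-diagonal block `F_ij = -(1 / (d_ij^(2κ) σ²)) p_ij p_ijᵀ` if `i` and `j` are neighbors,
and `0` otherwise. -/
noncomputable def fimBlock (model : NoiseModel) (σ : ℝ≥0) (G : SimpleGraph (U ⊕ K))
    (p : (U ⊕ K) × Fin n → ℝ) (i j : U ⊕ K) : Matrix (Fin n) (Fin n) ℝ :=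
  if G.Adj i j then
    -(1 / (‖relPos p i j‖ ^ (2 * model.kappa) * (σ : ℝ) ^ 2)) •
      Matrix.vecMulVec (relPos p i j).ofLp (relPos p i j).ofLp
  else 0

/-- The matrix with blocks `F_ij` for `i ≠ j` and `F_ii = -∑_{j ≠ i} F_ij`. -/
noncomputable def explicitFIM [DecidableEq U] [DecidableEq K] (model : NoiseModel) (σ : ℝ≥0)
    (G : SimpleGraph (U ⊕ K)) (p : (U ⊕ K) × Fin n → ℝ) :
    Matrix ((U ⊕ K) × Fin n) ((U ⊕ K) × Fin n) ℝ :=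
  Matrix.of fun ia jb =>
    if ia.1 = jb.1 then -∑ j ∈ Finset.univ.erase ia.1, fimBlock model σ G p ia.1 j ia.2 jb.2
    else fimBlock model σ G p ia.1 jb.1 ia.2 jb.2

/-- The tag block `F_U` of a matrix indexed by all node coordinates. -/
def tagBlock (F : Matrix ((U ⊕ K) × Fin n) ((U ⊕ K) × Fin n) ℝ) :
    Matrix (U × Fin n) (U × Fin n) ℝ :=
  F.submatrix (Prod.map Sum.inl id) (Prod.map Sum.inl id)

/-- The tag block `F_U` of the Fisher information matrix of the range measurements. -/
noncomputable def tagFIM [DecidableEq U] [DecidableEq K] (model : NoiseModel) (σ : ℝ≥0)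
    (G : SimpleGraph (U ⊕ K)) (p : (U ⊕ K) × Fin n → ℝ) : Matrix (U × Fin n) (U × Fin n) ℝ :=
  tagBlock (networkFIM model σ G p)

/-- The constrained Cramér-Rao bound `B_U = A (Aᵀ F_U A)† Aᵀ`. -/
noncomputable def constrainedBound {r : Type*} [Fintype r] [DecidableEq U] [DecidableEq K]
    (model : NoiseModel) (σ : ℝ≥0) (G : SimpleGraph (U ⊕ K)) (p : (U ⊕ K) × Fin n → ℝ)
    (A : Matrix (U × Fin n) r ℝ) : Matrix (U × Fin n) (U × Fin n) ℝ :=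
  A * pseudoInverse (Aᵀ * tagFIM model σ G p * A) * Aᵀ

/-- The set of tag positions that satisfy the constraints. -/
def feasibleTags {C : Type*} (fc : (U × Fin n → ℝ) → (C → ℝ)) : Set (U × Fin n → ℝ) :=
  {q | fc q = 0}

/-- The estimator `est` of the tag positions, a function of the range measurements, is unbiased
for all feasible tag positions in a neighborhood of `pU` (the anchors being kept at `pK`). -/
def IsUnbiasedNear {C : Type*} (model : NoiseModel) (σ : ℝ≥0) (G : SimpleGraph (U ⊕ K))
    (pK : K × Fin n → ℝ) (fc : (U × Fin n → ℝ) → (C → ℝ))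
    (est : (RangingPair G → ℝ) → (U × Fin n → ℝ)) (pU : U × Fin n → ℝ) : Prop :=
  ∀ᶠ q in 𝓝[feasibleTags fc] pU, ∀ i,
    Integrable (fun y => est y i) (rangeLaw model σ G (joinPos q pK)) ∧
    ∫ y, est y i ∂(rangeLaw model σ G (joinPos q pK)) = q i

end RangingNetwork

/-! Both noise models are one Gaussian location model in disguise. Through `link` (the identity or
`exp`), the measurements are images of independent normal variables of variance `σ²` whose means are
`d` or `ln d` (`rangeLaw_eq_map`). In these coordinates the log-density is a quadratic in the
residuals plus a term free of the positions. Taking the expectation of its Hessian removes the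
second derivatives of the means and leaves the Gram matrix of their first derivatives, divided by
`σ²` (`networkFIM_apply`). Differentiating the distances turns this into the explicit blocks.

The bound is a covariance inequality between the estimator and the score. The analytic core is
`hasFDerivAt_integral`: the mean of any function that is square integrable at `m` is differentiable
in the location at `m`, and its derivative in direction `h` is its correlation with the score. No
regularity of the estimator is needed, because the likelihood ratio is differentiable in L²: its
remainder after `1 + score` has second moment `exp I - 1 - I`, with `I` quadratic in `h`.

On the feasible set near `pU` the estimator's mean equals the tag position. The two derivatives
therefore agree on the tangent cone, hence on its span, which by regularity contains every vector `A
c` (`meanDeriv_tagJacobian`). So the covariance of `w · est` with the score along `A c` is `w · A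
c`, while the variance of that score is the Fisher form at `A c` (`info_tagJacobian`). Nonnegativity
of the variance of their difference gives a quadratic inequality in `w` and `c`. The choice `c = (Aᵀ
F A)† Aᵀ w` makes it the bound, even for singular information (`posSemidef_sub_of_quadratic`). -/

/-! ### Gaussian location families -/

namespace GaussianLocation

variable {ι : Type*} [Fintype ι]

/-- The law of a vector with independent coordinates `N(m e, v)`. -/
noncomputable def law (v : ℝ≥0) (m : ι → ℝ) : Measure (ι → ℝ) :=
  Measure.pi fun e => gaussianReal (m e) v

instance (v : ℝ≥0) (m : ι → ℝ) : IsProbabilityMeasure (law v m) := by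
  unfold law; infer_instance

/-- The derivative at `m` of the log-likelihood in the direction `h`. -/
noncomputable def score (v : ℝ≥0) (m h y : ι → ℝ) : ℝ :=
  ∑ e, h e / v * (y e - m e)

/-- The Fisher information at the direction `h`. -/
noncomputable def info (v : ℝ≥0) (h : ι → ℝ) : ℝ := ∑ e, h e ^ 2 / v

/-- The density of `law v (m + h)` with respect to `law v m`. -/
noncomputable def ratio (v : ℝ≥0) (m h y : ι → ℝ) : ℝ :=
  Real.exp (score v m h y - info v h / 2)

variable {v : ℝ≥0} {m : ι → ℝ}

theorem measurable_score (h : ι → ℝ) : Measurable (score v m h) := by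
  unfold score; fun_prop

theorem measurable_ratio (h : ι → ℝ) : Measurable (ratio v m h) :=
  Real.measurable_exp.comp ((measurable_score h).sub_const _)

theorem gaussianReal_shift (hv : v ≠ 0) (a b : ℝ) :
    gaussianReal (a + b) v = (gaussianReal a v).withDensity fun y =>
      ENNReal.ofReal (Real.exp (b / v * (y - a) - b ^ 2 / v / 2)) := by
  have hv' : (v : ℝ) ≠ 0 := by exact_mod_cast hv
  rw [gaussianReal_of_var_ne_zero _ hv, gaussianReal_of_var_ne_zero _ hv,
    ← withDensity_mul _ (measurable_gaussianPDF _ _) (by fun_prop)]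
  congr 1
  ext y
  rw [Pi.mul_apply, gaussianPDF, gaussianPDF, ← ENNReal.ofReal_mul (gaussianPDFReal_nonneg _ _ _)]
  congr 1
  rw [gaussianPDFReal, gaussianPDFReal, mul_assoc _ (Real.exp _), ← Real.exp_add]
  congr 2
  field_simp
  ring

/-- A product measure is determined by its values on boxes, where Fubini factors the integral of the
product density. -/
theorem pi_withDensity_ofReal {μ : ι → Measure ℝ} [∀ e, IsProbabilityMeasure (μ e)]
    {f : ι → ℝ → ℝ} (hf : ∀ e y, 0 ≤ f e y) (hint : ∀ e, Integrable (f e) (μ e))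
    [∀ e, IsProbabilityMeasure ((μ e).withDensity fun y => ENNReal.ofReal (f e y))] :
    Measure.pi (fun e => (μ e).withDensity fun y => ENNReal.ofReal (f e y)) =
      (Measure.pi μ).withDensity fun y => ENNReal.ofReal (∏ e, f e (y e)) := by
  refine Measure.pi_eq fun s hs => ?_
  rw [withDensity_apply _ (MeasurableSet.univ_pi hs), Measure.restrict_pi_pi]
  have h1 : Integrable (fun y : ι → ℝ => ∏ e, f e (y e))
      (Measure.pi fun e => (μ e).restrict (s e)) :=
    Integrable.fintype_prod_dep fun e => (hint e).restrict
  rw [← ofReal_integral_eq_lintegral_ofReal h1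
    (Filter.Eventually.of_forall fun y => Finset.prod_nonneg fun e _ => hf _ _),
    integral_fintype_prod_eq_prod (f := f),
    ENNReal.ofReal_prod_of_nonneg fun e _ => integral_nonneg (hf e)]
  refine Finset.prod_congr rfl fun e _ => ?_
  rw [withDensity_apply _ (hs e), ofReal_integral_eq_lintegral_ofReal (hint e).restrict
      (Filter.Eventually.of_forall (hf e))]

theorem law_add (hv : v ≠ 0) (m h : ι → ℝ) :
    law v (m + h) = (law v m).withDensity fun y => ENNReal.ofReal (ratio v m h y) := by
  have hp : ∀ e, IsProbabilityMeasure ((gaussianReal (m e) v).withDensity fun y =>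
      ENNReal.ofReal (Real.exp (h e / v * (y - m e) - h e ^ 2 / v / 2))) := fun e => by
    rw [← gaussianReal_shift hv]; infer_instance
  unfold law
  simp only [Pi.add_apply, gaussianReal_shift hv]
  rw [pi_withDensity_ofReal (fun e y => (Real.exp_pos _).le)]
  · congr 1
    ext y
    rw [← Real.exp_sum, ratio, score, info, Finset.sum_div, Finset.sum_sub_distrib]
  · intro e
    refine ⟨by fun_prop, ?_⟩
    rw [hasFiniteIntegral_iff_ofReal (Filter.Eventually.of_forall fun y => (Real.exp_pos _).le),
      ← setLIntegral_univ, ← withDensity_apply _ MeasurableSet.univ]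
    exact measure_lt_top _ _

/-- Change of measure. Nothing is assumed of `f`, since the density is measurable and finite. -/
theorem integral_law_add (hv : v ≠ 0) (m h : ι → ℝ) (f : (ι → ℝ) → ℝ) :
    ∫ y, f y ∂(law v (m + h)) = ∫ y, ratio v m h y * f y ∂(law v m) := by
  rw [law_add hv, integral_withDensity_eq_integral_toReal_smul
    (measurable_ratio h).ennreal_ofReal (Filter.Eventually.of_forall fun y => ENNReal.ofReal_lt_top)]
  simp [ratio, ENNReal.toReal_ofReal (Real.exp_pos _).le]

theorem integrable_ratio (hv : v ≠ 0) (m h : ι → ℝ) : Integrable (ratio v m h) (law v m) := by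
  refine ⟨(measurable_ratio h).aestronglyMeasurable, ?_⟩
  have h0 : ∀ y, 0 ≤ ratio v m h y := fun y => (Real.exp_pos _).le
  rw [hasFiniteIntegral_iff_ofReal (Filter.Eventually.of_forall h0),
    ← setLIntegral_univ, ← withDensity_apply _ MeasurableSet.univ, ← law_add hv]
  exact measure_lt_top _ _

theorem integral_ratio (hv : v ≠ 0) (m h : ι → ℝ) : ∫ y, ratio v m h y ∂(law v m) = 1 := by
  simpa using (integral_law_add hv m h fun _ => 1).symm

/-- Doubling `h` doubles the score and quadruples the information. Second moments of the ratio thus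
reduce to the total mass of another shifted law. -/
theorem ratio_sq (m h y : ι → ℝ) :
    ratio v m h y ^ 2 = Real.exp (info v h) * ratio v m ((2 : ℝ) • h) y := by
  rw [ratio, ratio, ← Real.exp_nat_mul, ← Real.exp_add]
  congr 1
  have h1 : score v m ((2 : ℝ) • h) y = 2 * score v m h y := by
    simp only [score, Finset.mul_sum, Pi.smul_apply, smul_eq_mul]
    exact Finset.sum_congr rfl fun e _ => by ring
  have h2 : info v ((2 : ℝ) • h) = 4 * info v h := by
    simp only [info, Finset.mul_sum, Pi.smul_apply, smul_eq_mul]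
    exact Finset.sum_congr rfl fun e _ => by ring
  rw [h1, h2]; push_cast; ring

theorem memLp_ratio (hv : v ≠ 0) (m h : ι → ℝ) : MemLp (ratio v m h) 2 (law v m) := by
  rw [memLp_two_iff_integrable_sq (measurable_ratio h).aestronglyMeasurable]
  simp only [ratio_sq]
  exact (integrable_ratio hv m _).const_mul _

theorem integral_ratio_sq (hv : v ≠ 0) (m h : ι → ℝ) :
    ∫ y, ratio v m h y ^ 2 ∂(law v m) = Real.exp (info v h) := by
  simp only [ratio_sq]
  rw [integral_const_mul, integral_ratio hv, mul_one]

/-- The centre `k` is kept apart from the mean `m` because the score at `m` is also integrated under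
the law with mean `m + h`. -/
theorem memLp_coord (m k : ι → ℝ) (e : ι) : MemLp (fun y => y e - k e) 2 (law v m) :=
  (((memLp_id_gaussianReal' 2 (by simp)).comp_measurePreserving
    (measurePreserving_eval (fun e => gaussianReal (m e) v) e)).sub (memLp_const (k e)) : _)

theorem integral_coord (m k : ι → ℝ) (e : ι) : ∫ y, (y e - k e) ∂(law v m) = m e - k e := by
  have h : Integrable (fun y : ι → ℝ => y e) (law v m) := by
    simpa using (memLp_coord (v := v) m 0 e).integrable (by norm_num)
  rw [integral_sub h (integrable_const _)]
  congr 1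
  · exact (integral_eval (μ := fun e => gaussianReal (m e) v)).trans integral_id_gaussianReal
  · simp

theorem memLp_score (m k h : ι → ℝ) : MemLp (score v k h) 2 (law v m) := by
  have : score v k h = fun y => ∑ e, h e / v * (y e - k e) := rfl
  rw [this]
  exact memLp_finsetSum _ fun e _ => (memLp_coord m k e).const_mul _

theorem integral_score (m k h : ι → ℝ) :
    ∫ y, score v k h y ∂(law v m) = ∑ e, h e / v * (m e - k e) := by
  simp only [score]
  rw [integral_finsetSum _ fun e _ =>
    ((memLp_coord m k e).const_mul _).integrable (by norm_num)]
  simp only [integral_const_mul, integral_coord]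

theorem integral_score_self (m h : ι → ℝ) : ∫ y, score v m h y ∂(law v m) = 0 := by
  simp [integral_score]

theorem variance_score (hv : v ≠ 0) (m h : ι → ℝ) : Var[score v m h; law v m] = info v h := by
  have hv' : (v : ℝ) ≠ 0 := by exact_mod_cast hv
  have hX : ∀ e, MemLp (fun x : ℝ => h e / v * (x - m e)) 2 (gaussianReal (m e) v) := fun e =>
    ((memLp_id_gaussianReal' 2 (by simp)).sub (memLp_const (m e))).const_mul _
  have := variance_sum_pi hX
  have h1 : (∑ i, fun ω : ι → ℝ => h i / v * (ω i - m i)) = score v m h := by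
    ext y; simp [score]
  rw [h1] at this
  rw [law, this, info]
  refine Finset.sum_congr rfl fun e _ => ?_
  rw [variance_const_mul, variance_sub_const (X := fun x => x) aestronglyMeasurable_id,
    variance_fun_id_gaussianReal]
  field_simp

theorem integral_score_sq (hv : v ≠ 0) (m h : ι → ℝ) :
    ∫ y, score v m h y ^ 2 ∂(law v m) = info v h := by
  rw [← variance_score hv m h, variance_of_integral_eq_zero (measurable_score h).aemeasurable
    (integral_score_self m h)]

theorem integral_ratio_mul_score (hv : v ≠ 0) (m h : ι → ℝ) :
    ∫ y, ratio v m h y * score v m h y ∂(law v m) = info v h := by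
  rw [← integral_law_add hv, integral_score, info]
  exact Finset.sum_congr rfl fun e _ => by simp; ring

/-- Quantitative L² differentiability of the likelihood ratio. With `I` the information, expanding
the square uses the moments `E R² = exp I`, `E S² = E RS = I`, `E R = 1` and `E S = 0`. -/
theorem integral_ratio_sub_sq (hv : v ≠ 0) (m h : ι → ℝ) :
    ∫ y, (ratio v m h y - 1 - score v m h y) ^ 2 ∂(law v m) =
      Real.exp (info v h) - 1 - info v h := by
  have hR := memLp_ratio hv m h
  have hS := memLp_score (v := v) m m h
  have i1 := hR.integrable_sq
  have i2 := hS.integrable_sq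
  have i3 : Integrable (fun y => ratio v m h y * score v m h y) (law v m) := hR.integrable_mul hS
  have i4 := hR.integrable (by norm_num : (1 : ℝ≥0∞) ≤ 2)
  have i5 := hS.integrable (by norm_num : (1 : ℝ≥0∞) ≤ 2)
  have : ∀ y, (ratio v m h y - 1 - score v m h y) ^ 2 =
      ratio v m h y ^ 2 + score v m h y ^ 2 - 2 * (ratio v m h y * score v m h y)
        - 2 * ratio v m h y + 2 * score v m h y + 1 := fun y => by ring
  simp only [this]
  rw [integral_add (by fun_prop) (by fun_prop), integral_add (by fun_prop) (by fun_prop),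
    integral_sub (by fun_prop) (by fun_prop), integral_sub (by fun_prop) (by fun_prop),
    integral_add (by fun_prop) (by fun_prop)]
  simp only [integral_const_mul, integral_ratio_sq hv, integral_score_sq hv,
    integral_ratio_mul_score hv, integral_ratio hv, integral_score_self]
  simp
  ring

theorem abs_integral_mul_le_sqrt {Ω : Type*} [MeasurableSpace Ω] {μ : Measure Ω} {X Y : Ω → ℝ}
    (hX : MemLp X 2 μ) (hY : MemLp Y 2 μ) :
    |∫ y, X y * Y y ∂μ| ≤ √(∫ y, X y ^ 2 ∂μ) * √(∫ y, Y y ^ 2 ∂μ) := by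
  have h := integral_mul_norm_le_Lp_mul_Lq (μ := μ) (f := X) (g := Y) (p := 2) (q := 2)
    Real.HolderConjugate.two_two (by simpa using hX) (by simpa using hY)
  refine (abs_integral_le_integral_abs).trans ?_
  simpa [abs_mul, Real.sqrt_eq_rpow] using h

/-- The derivative of the mean of `X` at `law v m`. -/
noncomputable def meanDeriv (v : ℝ≥0) (m : ι → ℝ) (X : (ι → ℝ) → ℝ) : (ι → ℝ) →L[ℝ] ℝ :=
  ∑ e, (∫ y, X y * ((y e - m e) / v) ∂(law v m)) • ContinuousLinearMap.proj e

theorem meanDeriv_apply {X : (ι → ℝ) → ℝ} (hX : MemLp X 2 (law v m)) (h : ι → ℝ) :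
    meanDeriv v m X h = ∫ y, X y * score v m h y ∂(law v m) := by
  simp only [score, Finset.mul_sum]
  have hi : ∀ e, Integrable (fun y => X y * ((y e - m e) / v)) (law v m) := fun e =>
    hX.integrable_mul (by simpa [div_eq_inv_mul] using (memLp_coord m m e).const_mul (v : ℝ)⁻¹)
  have hr : ∀ e y, X y * (h e / v * (y e - m e)) = h e * (X y * ((y e - m e) / v)) :=
    fun e y => by ring
  simp only [hr]
  rw [integral_finsetSum _ fun e _ => (hi e).const_mul _]
  simp [meanDeriv, integral_const_mul, mul_comm]

theorem info_nonneg (h : ι → ℝ) : 0 ≤ info v h :=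
  Finset.sum_nonneg fun e _ => by positivity

theorem info_le (h : ι → ℝ) : info v h ≤ Fintype.card ι / v * ‖h‖ ^ 2 := by
  calc info v h ≤ ∑ _e : ι, ‖h‖ ^ 2 / v := Finset.sum_le_sum fun e _ => by
        have : h e ^ 2 ≤ ‖h‖ ^ 2 := by
          rw [← sq_abs]; exact pow_le_pow_left₀ (abs_nonneg _) (norm_le_pi_norm h e) 2
        gcongr
    _ = _ := by simp; ring

/-- The mean of a square integrable function is differentiable in the location parameter. -/
theorem hasFDerivAt_integral (hv : v ≠ 0) {X : (ι → ℝ) → ℝ} (hX : MemLp X 2 (law v m)) :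
    HasFDerivAt (fun k => ∫ y, X y ∂(law v k)) (meanDeriv v m X) m := by
  rw [hasFDerivAt_iff_isLittleO_nhds_zero]
  -- Cauchy–Schwarz separates `X` from the L² remainder of the ratio. The cardinality appears
  -- because `‖h‖` is the sup norm.
  have key : ∀ h : ι → ℝ, ‖h‖ ^ 2 * (Fintype.card ι / v) ≤ 1 →
      |∫ y, X y ∂(law v (m + h)) - ∫ y, X y ∂(law v m) - meanDeriv v m X h| ≤
        √(∫ y, X y ^ 2 ∂(law v m)) * (Fintype.card ι / v) * ‖h‖ ^ 2 := by
    intro h hh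
    have hR := memLp_ratio hv m h
    have hS := memLp_score (v := v) m m h
    have hD : MemLp (fun y => ratio v m h y - 1 - score v m h y) 2 (law v m) :=
      (hR.sub (memLp_const 1)).sub hS
    have e1 : ∫ y, X y ∂(law v (m + h)) - ∫ y, X y ∂(law v m) - meanDeriv v m X h =
        ∫ y, X y * (ratio v m h y - 1 - score v m h y) ∂(law v m) := by
      rw [integral_law_add hv, meanDeriv_apply hX, ← integral_sub, ← integral_sub]
      · congr 1; ext y; ring
      · exact (hR.integrable_mul hX).sub (hX.integrable (by norm_num))
      · exact hX.integrable_mul hS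
      · exact hR.integrable_mul hX
      · exact hX.integrable (by norm_num)
    rw [e1]
    refine (abs_integral_mul_le_sqrt hX hD).trans ?_
    rw [integral_ratio_sub_sq hv, mul_assoc]
    gcongr
    have hle : info v h ≤ Fintype.card ι / v * ‖h‖ ^ 2 := info_le h
    have h1 : |info v h| ≤ 1 := by
      rw [abs_of_nonneg (info_nonneg h)]; linarith
    -- The estimate `|exp x - 1 - x| ≤ x²` requires `|x| ≤ 1`, hence the smallness condition on `h`.
    calc √(Real.exp (info v h) - 1 - info v h) ≤ √(info v h ^ 2) :=
          Real.sqrt_le_sqrt ((le_abs_self _).trans (Real.abs_exp_sub_one_sub_id_le h1))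
      _ = info v h := Real.sqrt_sq (info_nonneg h)
      _ ≤ _ := hle
  have hsmall : ∀ᶠ h : ι → ℝ in 𝓝 0, ‖h‖ ^ 2 * (Fintype.card ι / v) ≤ 1 := by
    have hc : Continuous fun h : ι → ℝ => ‖h‖ ^ 2 * (Fintype.card ι / v : ℝ) := by fun_prop
    exact (hc.tendsto 0).eventually_le_const (by simp)
  refine Asymptotics.IsBigO.trans_isLittleO (g := fun h : ι → ℝ => ‖h‖ ^ 2) ?_ ?_
  · refine Asymptotics.IsBigO.of_bound
      (√(∫ y, X y ^ 2 ∂(law v m)) * (Fintype.card ι / v)) ?_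
    filter_upwards [hsmall] with h hh
    simpa using key h hh
  · exact Asymptotics.isLittleO_norm_pow_id one_lt_two

end GaussianLocation

/-- Product rule applied twice. The second derivatives of `m` occur only multiplied by the residuals
`z e - m e x`, which have mean zero in the application. -/
theorem hessianMatrix_quadratic_residual {ι κ : Type*} [Fintype ι] [DecidableEq ι] [Fintype κ]
    {m : κ → (ι → ℝ) → ℝ} {x : ι → ℝ} (hm : ∀ e, ContDiffAt ℝ 2 (m e) x)
    (c v : ℝ) (z : κ → ℝ) (i j : ι) :
    hessianMatrix (fun p => c - ∑ e, (z e - m e p) ^ 2 / (2 * v)) x i j =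
      ∑ e, (z e - m e x) * (hessianMatrix (m e) x i j / v) -
      ∑ e, fderiv ℝ (m e) x (Pi.single i 1) * fderiv ℝ (m e) x (Pi.single j 1) / v := by
  have hd : ∀ᶠ p in 𝓝 x, ∀ e, DifferentiableAt ℝ (m e) p := by
    refine Filter.eventually_all.mpr fun e => ?_
    filter_upwards [(hm e).eventually (by simp)] with p hp using hp.differentiableAt (by simp)
  have h1 : (fun p => fderiv ℝ (fun p => c - ∑ e, (z e - m e p) ^ 2 / (2 * v)) p (Pi.single j 1))
      =ᶠ[𝓝 x] fun p => ∑ e, (z e - m e p) * (fderiv ℝ (m e) p (Pi.single j 1) / v) := by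
    filter_upwards [hd] with p hp
    have : HasFDerivAt (fun p => c - ∑ e, (z e - m e p) ^ 2 / (2 * v))
        (-∑ e, (2 * v)⁻¹ • ((2 : ℕ) • (z e - m e p) ^ (2 - 1)) • (-fderiv ℝ (m e) p)) p := by
      refine HasFDerivAt.const_sub (HasFDerivAt.fun_sum fun e _ => ?_) _
      simp only [div_eq_inv_mul]
      exact HasFDerivAt.const_mul (((hp e).hasFDerivAt.const_sub _).pow 2) _
    rw [this.fderiv]
    simp only [neg_apply, sum_apply,
      smul_apply, smul_eq_mul, ← Finset.sum_neg_distrib]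
    refine Finset.sum_congr rfl fun e _ => ?_
    simp
    ring
  have h2 : ∀ e, DifferentiableAt ℝ (fun p => fderiv ℝ (m e) p (Pi.single j 1)) x := fun e =>
    (((hm e).fderiv_right (m := 1) (by norm_num)).differentiableAt (by simp)).clm_apply
      (differentiableAt_const _)
  rw [hessianMatrix, Matrix.of_apply, h1.fderiv_eq]
  have h3 : HasFDerivAt (fun p => ∑ e, (z e - m e p) * (fderiv ℝ (m e) p (Pi.single j 1) / v))
      (∑ e, ((z e - m e x) • v⁻¹ • fderiv ℝ (fun p => fderiv ℝ (m e) p (Pi.single j 1)) x +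
        (fderiv ℝ (m e) x (Pi.single j 1) / v) • (-fderiv ℝ (m e) x))) x := by
    refine HasFDerivAt.fun_sum fun e _ => ?_
    refine HasFDerivAt.mul ((hd.self_of_nhds e).hasFDerivAt.const_sub _) ?_
    simp only [div_eq_inv_mul]
    exact (h2 e).hasFDerivAt.const_mul _
  rw [h3.fderiv, ← Finset.sum_sub_distrib]
  simp only [sum_apply]
  refine Finset.sum_congr rfl fun e _ => ?_
  simp [hessianMatrix]
  ring

/-! ### Reduction of both noise models to a Gaussian location family, and the Fisher information. -/

namespace RangingNetwork

namespace NoiseModel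

/-- The location parameter of the Gaussian model that is equivalent to the model. -/
noncomputable def location : NoiseModel → ℝ → ℝ
  | additive, d => d
  | multiplicative, d => Real.log d

/-- The map that turns a Gaussian observation into a measurement. -/
noncomputable def link : NoiseModel → ℝ → ℝ
  | additive, z => z
  | multiplicative, z => Real.exp z

/-- The left inverse of `link`. -/
noncomputable def unlink : NoiseModel → ℝ → ℝ
  | additive, y => y
  | multiplicative, y => Real.log y

@[simp] theorem unlink_link (model : NoiseModel) (z : ℝ) : model.unlink (model.link z) = z := by
  cases model <;> simp [link, unlink]

theorem measurable_link (model : NoiseModel) : Measurable model.link := by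
  cases model
  · exact measurable_id
  · exact Real.measurable_exp

theorem measurable_unlink (model : NoiseModel) : Measurable model.unlink := by
  cases model
  · exact measurable_id
  · exact Real.measurable_log

theorem law_eq_map_link (model : NoiseModel) (σ : ℝ≥0) {d : ℝ} (hd : 0 < d) :
    model.law σ d = (gaussianReal (model.location d) (σ ^ 2)).map model.link := by
  have h : gaussianReal (model.location d) (σ ^ 2) =
      (gaussianReal 0 (σ ^ 2)).map (fun ν => model.location d + ν) := by
    rw [gaussianReal_map_const_add, zero_add]
  rw [h, Measure.map_map model.measurable_link (measurable_const_add _), law]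
  congr 1
  ext ν
  cases model
  · rfl
  · simp [observe, link, location, Real.exp_add, Real.exp_log hd]

/-- The point is that `c` does not depend on `d`: it absorbs the normalization and, for log-normal
noise, the factor `1 / y`, so it disappears on differentiating in the positions. -/
theorem exists_log_pdf_link (model : NoiseModel) {σ : ℝ≥0} (hσ : 0 < σ) (z : ℝ) :
    ∃ c, ∀ d, model.pdf σ d (model.link z) ≠ 0 ∧ Real.log (model.pdf σ d (model.link z)) =
      c - (z - model.location d) ^ 2 / (2 * (σ : ℝ) ^ 2) := by
  have hv : σ ^ 2 ≠ 0 := (pow_pos hσ 2).ne'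
  have hg : ∀ a, Real.log (gaussianPDFReal a (σ ^ 2) z) =
      Real.log (√(2 * Real.pi * (σ : ℝ) ^ 2))⁻¹ - (z - a) ^ 2 / (2 * (σ : ℝ) ^ 2) := fun a => by
    rw [gaussianPDFReal, Real.log_mul (by positivity) (Real.exp_pos _).ne', Real.log_exp]
    push_cast
    ring
  cases model with
  | additive => exact ⟨_, fun d => ⟨(gaussianPDFReal_pos _ _ _ hv).ne', hg d⟩⟩
  | multiplicative =>
    refine ⟨Real.log (Real.exp z)⁻¹ + Real.log (√(2 * Real.pi * (σ : ℝ) ^ 2))⁻¹, fun d => ?_⟩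
    have h0 := (gaussianPDFReal_pos (Real.log d) _ z hv).ne'
    simp only [pdf, link, location, if_pos (Real.exp_pos z), Real.log_exp z]
    refine ⟨mul_ne_zero (inv_ne_zero (Real.exp_pos _).ne') h0, ?_⟩
    rw [Real.log_mul (inv_ne_zero (Real.exp_pos _).ne') h0, hg]
    simp only [Real.log_inv, Real.log_exp]
    ring

end NoiseModel

variable {U K : Type*} {n : ℕ}

/-- The location parameter of the measurement of a pair. -/
noncomputable def pairLocation (model : NoiseModel) (e : Sym2 (U ⊕ K))
    (p : (U ⊕ K) × Fin n → ℝ) : ℝ :=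
  model.location (pairDist p e)

/-- The location parameters of all range measurements. -/
noncomputable def rangeLocation (model : NoiseModel) (G : SimpleGraph (U ⊕ K))
    (p : (U ⊕ K) × Fin n → ℝ) (e : RangingPair G) : ℝ :=
  pairLocation model e p

theorem pairDist_nonneg (p : (U ⊕ K) × Fin n → ℝ) (e : Sym2 (U ⊕ K)) : 0 ≤ pairDist p e := by
  induction e with | _ i j => exact norm_nonneg (relPos p i j)

theorem measurable_link_pi (model : NoiseModel) (G : SimpleGraph (U ⊕ K)) :
    Measurable fun (z : RangingPair G → ℝ) e => model.link (z e) :=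
  measurable_pi_lambda _ fun e => model.measurable_link.comp (measurable_pi_apply e)

variable [Fintype U] [Fintype K]

theorem rangeLaw_eq_map (model : NoiseModel) (σ : ℝ≥0) (G : SimpleGraph (U ⊕ K))
    {p : (U ⊕ K) × Fin n → ℝ} (hp : ∀ e : RangingPair G, pairDist p e ≠ 0) :
    rangeLaw model σ G p = (GaussianLocation.law (σ ^ 2) (rangeLocation model G p)).map
      fun z e => model.link (z e) := by
  have hprob : ∀ e : RangingPair G, IsProbabilityMeasure
      ((gaussianReal (rangeLocation model G p e) (σ ^ 2)).map model.link) := fun e =>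
    Measure.isProbabilityMeasure_map model.measurable_link.aemeasurable
  rw [GaussianLocation.law, Measure.pi_map_pi fun e => model.measurable_link.aemeasurable, rangeLaw]
  congr 1
  ext1 e
  exact model.law_eq_map_link σ ((pairDist_nonneg p e).lt_of_ne' (hp e))

theorem exists_log_rangePDF_link (model : NoiseModel) {σ : ℝ≥0} (hσ : 0 < σ)
    (G : SimpleGraph (U ⊕ K)) (z : RangingPair G → ℝ) :
    ∃ c, ∀ p : (U ⊕ K) × Fin n → ℝ,
      Real.log (rangePDF model σ G (fun e => model.link (z e)) p) =
        c - ∑ e : RangingPair G, (z e - pairLocation model e p) ^ 2 / (2 * (σ : ℝ) ^ 2) := by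
  choose c hc using fun e => model.exists_log_pdf_link hσ (z e)
  refine ⟨∑ e, c e, fun p => ?_⟩
  rw [rangePDF, Real.log_prod fun e _ => (hc e _).1, ← Finset.sum_sub_distrib]
  exact Finset.sum_congr rfl fun e _ => (hc e _).2

variable [DecidableEq U] [DecidableEq K]

theorem networkFIM_apply (model : NoiseModel) {σ : ℝ≥0} (hσ : 0 < σ)
    (G : SimpleGraph (U ⊕ K)) {p : (U ⊕ K) × Fin n → ℝ}
    (hp : ∀ e : RangingPair G, pairDist p e ≠ 0)
    (hm : ∀ e : RangingPair G, ContDiffAt ℝ 2 (pairLocation model (n := n) (e : Sym2 (U ⊕ K))) p)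
    (i j : (U ⊕ K) × Fin n) :
    networkFIM model σ G p i j = ∑ e : RangingPair G,
      fderiv ℝ (pairLocation model (e : Sym2 (U ⊕ K))) p (Pi.single i 1) *
      fderiv ℝ (pairLocation model (e : Sym2 (U ⊕ K))) p (Pi.single j 1) / (σ : ℝ) ^ 2 := by
  rw [networkFIM, fisherInformation, Matrix.of_apply]
  -- Only almost sure: for multiplicative noise `exp (log y) = y` needs `0 < y`.
  have hlink : ∀ᵐ y ∂(rangeLaw model σ G p), (fun e => model.link (model.unlink (y e))) = y := by
    have hset : MeasurableSet {y : RangingPair G → ℝ |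
        (fun e => model.link (model.unlink (y e))) = y} :=
      measurableSet_eq_fun ((measurable_link_pi model G).comp (measurable_pi_lambda _ fun e =>
        model.measurable_unlink.comp (measurable_pi_apply e))) measurable_id
    rw [rangeLaw_eq_map model σ G hp, ae_map_iff (measurable_link_pi model G).aemeasurable hset]
    exact Filter.Eventually.of_forall fun z => by simp
  set H : RangingPair G → ℝ := fun e =>
    hessianMatrix (pairLocation model (e : Sym2 (U ⊕ K))) p i j / (σ : ℝ) ^ 2
  set I : ℝ := ∑ e : RangingPair G,
      fderiv ℝ (pairLocation model (e : Sym2 (U ⊕ K))) p (Pi.single i 1) *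
      fderiv ℝ (pairLocation model (e : Sym2 (U ⊕ K))) p (Pi.single j 1) / (σ : ℝ) ^ 2
  have heq : ∀ᵐ y ∂(rangeLaw model σ G p),
      hessianMatrix (fun x => Real.log (rangePDF model σ G y x)) p i j =
        ∑ e, (model.unlink (y e) - rangeLocation model G p e) * H e - I := by
    filter_upwards [hlink] with y hy
    obtain ⟨c, hc⟩ := exists_log_rangePDF_link (n := n) model hσ G fun e => model.unlink (y e)
    rw [hy] at hc
    simp only [hc]
    exact hessianMatrix_quadratic_residual hm c _ _ i j
  have hmeas : ∀ e : RangingPair G, Measurable fun y : RangingPair G → ℝ => model.unlink (y e) :=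
    fun e => model.measurable_unlink.comp (measurable_pi_apply e)
  rw [integral_congr_ae heq, rangeLaw_eq_map model σ G hp,
    integral_map (measurable_link_pi model G).aemeasurable
      ((Finset.measurable_sum _ fun e _ => ((hmeas e).sub_const _).mul_const _).sub_const
        _).aestronglyMeasurable]
  simp only [NoiseModel.unlink_link]
  have hi : ∀ e : RangingPair G, Integrable (fun z => (z e - rangeLocation model G p e) * H e)
      (GaussianLocation.law (σ ^ 2) (rangeLocation model G p)) := fun e =>
    ((GaussianLocation.memLp_coord _ _ e).integrable (by norm_num)).mul_const _
  rw [integral_sub (integrable_finsetSum _ fun e _ => hi e) (integrable_const _),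
    integral_finsetSum _ fun e _ => hi e]
  simp [integral_mul_const, GaussianLocation.integral_coord]

end RangingNetwork

/-! ### Derivatives of the distances and the explicit tag block. -/

namespace RangingNetwork

variable {U K : Type*} {n : ℕ}

theorem pairDist_ne_zero_of_adj {G : SimpleGraph (U ⊕ K)} {p : (U ⊕ K) × Fin n → ℝ}
    (hp : ∀ e : RangingPair G, pairDist p e ≠ 0) {u : U} {j : U ⊕ K} (h : G.Adj (Sum.inl u) j) :
    ‖relPos p (Sum.inl u) j‖ ≠ 0 :=
  hp ⟨s(Sum.inl u, j), h, u, Sym2.mem_mk_left _ _⟩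

/-- A coordinate of the relative position of two nodes, as a linear functional. -/
noncomputable def relCoord (i j : U ⊕ K) (a : Fin n) : ((U ⊕ K) × Fin n → ℝ) →L[ℝ] ℝ :=
  ContinuousLinearMap.proj (R := ℝ) (φ := fun _ : (U ⊕ K) × Fin n => ℝ) (i, a) -
    ContinuousLinearMap.proj (j, a)

theorem relCoord_single [DecidableEq U] [DecidableEq K] (i j k : U ⊕ K) (a b : Fin n) :
    relCoord i j b (Pi.single (k, a) 1) =
      if b = a then (if k = i then 1 else 0) - (if k = j then 1 else 0) else 0 := by
  simp only [relCoord, sub_apply, ContinuousLinearMap.proj_apply, Pi.single_apply, Prod.mk.injEq]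
  by_cases h : b = a <;> simp [h, eq_comm]

variable [Fintype U] [Fintype K]

theorem contDiffAt_pairLocation (model : NoiseModel) {e : Sym2 (U ⊕ K)}
    {p : (U ⊕ K) × Fin n → ℝ} (hp : pairDist p e ≠ 0) :
    ContDiffAt ℝ 2 (pairLocation model (n := n) e) p := by
  have hd : ContDiffAt ℝ 2 (fun p : (U ⊕ K) × Fin n → ℝ => pairDist p e) p := by
    induction e with | _ i j =>
    refine ContDiffAt.norm ℝ (f := fun q : (U ⊕ K) × Fin n → ℝ => relPos q i j) ?_
      (norm_ne_zero_iff.mp hp)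
    unfold relPos
    fun_prop
  cases model
  · exact hd
  · exact hd.log hp

theorem hasFDerivAt_pairDist {p : (U ⊕ K) × Fin n → ℝ} {i j : U ⊕ K}
    (hp : ‖relPos p i j‖ ≠ 0) :
    HasFDerivAt (fun q : (U ⊕ K) × Fin n → ℝ => pairDist q s(i, j))
      (∑ a, (relPos p i j a / ‖relPos p i j‖) • relCoord i j a) p := by
  have h1 : ∀ q : (U ⊕ K) × Fin n → ℝ, pairDist q s(i, j) = √(∑ a, (q (i, a) - q (j, a)) ^ 2) :=
    fun q => by
      change ‖relPos q i j‖ = _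
      simp [EuclideanSpace.norm_eq, relPos]
  have h2 : ∑ a, (p (i, a) - p (j, a)) ^ 2 ≠ 0 := fun h => hp (by
    change pairDist p s(i, j) = 0
    rw [h1, h, Real.sqrt_zero])
  have h3 : HasFDerivAt (fun q : (U ⊕ K) × Fin n → ℝ => ∑ a, (q (i, a) - q (j, a)) ^ 2)
      (∑ a, ((2 : ℕ) • (p (i, a) - p (j, a)) ^ (2 - 1)) • relCoord i j a) p :=
    HasFDerivAt.fun_sum fun a _ => ((relCoord i j a).hasFDerivAt (x := p)).pow 2
  have h4 := h3.sqrt h2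
  rw [← h1] at h4
  simp only [h1]
  refine h4.congr_fderiv ?_
  rw [Finset.smul_sum]
  refine Finset.sum_congr rfl fun a _ => ?_
  rw [smul_smul]
  congr 1
  change _ = (p (i, a) - p (j, a)) / pairDist p s(i, j)
  have : pairDist p s(i, j) ≠ 0 := hp
  simp
  field_simp

/-- The partial derivatives of the location parameter of the measurement of the pair `i, j`. -/
theorem fderiv_pairLocation_single [DecidableEq U] [DecidableEq K] (model : NoiseModel)
    {p : (U ⊕ K) × Fin n → ℝ} {i j : U ⊕ K} (hp : ‖relPos p i j‖ ≠ 0) (k : U ⊕ K) (a : Fin n) :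
    fderiv ℝ (pairLocation model s(i, j)) p (Pi.single (k, a) 1) =
      relPos p i j a / ‖relPos p i j‖ ^ model.kappa *
        ((if k = i then 1 else 0) - (if k = j then 1 else 0)) := by
  have hsum : (∑ b, (relPos p i j b / ‖relPos p i j‖) • relCoord i j b) (Pi.single (k, a) 1) =
      relPos p i j a / ‖relPos p i j‖ *
        ((if k = i then 1 else 0) - (if k = j then 1 else 0)) := by
    simp [relCoord_single]
  have hd := hasFDerivAt_pairDist hp
  cases model with
  | additive =>
    have : pairLocation (n := n) .additive s(i, j) = fun q => pairDist q s(i, j) := rfl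
    rw [this, hd.fderiv, hsum, NoiseModel.kappa, pow_one]
  | multiplicative =>
    have : pairLocation (n := n) .multiplicative s(i, j) =
      fun q => Real.log (pairDist q s(i, j)) := rfl
    rw [this, (hd.log hp).fderiv, smul_apply, hsum, NoiseModel.kappa, smul_eq_mul]
    change ‖relPos p i j‖⁻¹ * _ = _
    field_simp

/-- A sum over the ranging pairs that only involves the pairs containing a tag `u`. -/
theorem sum_rangingPair_eq_sum_neighbors (G : SimpleGraph (U ⊕ K)) [DecidableRel G.Adj] (u : U)
    (f : Sym2 (U ⊕ K) → ℝ) (hf : ∀ e : RangingPair G, Sum.inl u ∉ (e : Sym2 (U ⊕ K)) → f e = 0) :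
    ∑ e : RangingPair G, f e = ∑ j, if G.Adj (Sum.inl u) j then f s(Sum.inl u, j) else 0 := by
  classical
  rw [← Finset.sum_filter]
  symm
  refine Finset.sum_bij_ne_zero (fun j hj _ => (⟨s(Sum.inl u, j),
    (Finset.mem_filter.mp hj).2, u, Sym2.mem_mk_left _ _⟩ : RangingPair G)) ?_ ?_ ?_ ?_
  · simp
  · intro j _ _ j' _ _ h
    exact Sym2.congr_right.mp (congrArg Subtype.val h)
  · rintro ⟨e, he, hu⟩ _ hne
    have hmem : Sum.inl u ∈ e := by
      by_contra h
      exact hne (hf ⟨e, he, hu⟩ h)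
    obtain ⟨j, rfl⟩ := hmem
    exact ⟨j, by simpa using he, hne, rfl⟩
  · intros; rfl

variable [DecidableEq U] [DecidableEq K]

theorem tagFIM_apply (model : NoiseModel) {σ : ℝ≥0} (hσ : 0 < σ)
    (G : SimpleGraph (U ⊕ K)) {p : (U ⊕ K) × Fin n → ℝ}
    (hp : ∀ e : RangingPair G, pairDist p e ≠ 0) (i j : U × Fin n) :
    tagFIM model σ G p i j = ∑ e : RangingPair G,
      fderiv ℝ (pairLocation model (e : Sym2 (U ⊕ K))) p (Pi.single (Sum.inl i.1, i.2) 1) *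
      fderiv ℝ (pairLocation model (e : Sym2 (U ⊕ K))) p (Pi.single (Sum.inl j.1, j.2) 1) /
        (σ : ℝ) ^ 2 :=
  networkFIM_apply model hσ G hp (fun e => contDiffAt_pairLocation model (hp e)) _ _

/-- A row of tag `u` only sees pairs containing `u`, which correspond to the neighbors of `u`. All
these edges are measured, so the absence of anchor–anchor measurements does not affect the tag
block. -/
theorem tagFIM_eq_tagBlock_explicitFIM (model : NoiseModel) {σ : ℝ≥0} (hσ : 0 < σ)
    (G : SimpleGraph (U ⊕ K)) {p : (U ⊕ K) × Fin n → ℝ}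
    (hp : ∀ e : RangingPair G, pairDist p e ≠ 0) :
    tagFIM model σ G p = tagBlock (explicitFIM model σ G p) := by
  classical
  ext ⟨u, a⟩ ⟨w, b⟩
  rw [tagFIM_apply model hσ G hp]
  rw [sum_rangingPair_eq_sum_neighbors G u (fun e =>
    fderiv ℝ (pairLocation model e) p (Pi.single (Sum.inl u, a) 1) *
      fderiv ℝ (pairLocation model e) p (Pi.single (Sum.inl w, b) 1) / (σ : ℝ) ^ 2)]
  · have hterm : ∀ j, (if G.Adj (Sum.inl u) j then
        fderiv ℝ (pairLocation model s(Sum.inl u, j)) p (Pi.single (Sum.inl u, a) 1) *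
        fderiv ℝ (pairLocation model s(Sum.inl u, j)) p (Pi.single (Sum.inl w, b) 1) / (σ : ℝ) ^ 2
        else 0) = -fimBlock model σ G p (Sum.inl u) j a b *
          ((if w = u then 1 else 0) - (if Sum.inl w = j then 1 else 0)) := by
      intro j
      by_cases h : G.Adj (Sum.inl u) j
      · have hne := pairDist_ne_zero_of_adj hp h
        have huj : (Sum.inl u : U ⊕ K) ≠ j := h.ne
        rw [if_pos h, fderiv_pairLocation_single model hne, fderiv_pairLocation_single model hne,
          fimBlock, if_pos h]
        simp only [huj, if_true, if_false, sub_zero, mul_one, Sum.inl.injEq, Matrix.smul_apply,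
          Matrix.vecMulVec_apply, smul_eq_mul]
        -- Writes `d ^ (2κ)` as `(d ^ κ) ^ 2`, one factor for each partial derivative.
        rw [pow_mul', ← one_div_mul_one_div]
        field_simp
      · simp [h, fimBlock]
    simp only [hterm]
    by_cases huw : w = u
    · subst huw
      simp only [tagBlock, explicitFIM, Matrix.submatrix_apply, Matrix.of_apply, Prod.map_fst,
        Prod.map_snd, if_true, id]
      rw [← Finset.sum_neg_distrib, ← Finset.add_sum_erase _ _ (Finset.mem_univ (Sum.inl w))]
      simp only [if_true, sub_self, mul_zero, zero_add]
      refine Finset.sum_congr rfl fun j hj => ?_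
      rw [if_neg (Finset.ne_of_mem_erase hj).symm]
      ring
    -- Two distinct tags share at most the pair joining them.
    · rw [Finset.sum_eq_single (Sum.inl w) (fun j _ hj => by simp [huw, hj.symm]) (by simp)]
      simp [tagBlock, explicitFIM, huw, Ne.symm huw]
  · rintro ⟨e, he, hu⟩ hmem
    have hpe : pairDist p e ≠ 0 := hp ⟨e, he, hu⟩
    induction e with | _ i j =>
    rw [fderiv_pairLocation_single model hpe]
    simp only [Sym2.mem_iff, not_or] at hmem
    simp [hmem.1, hmem.2]

end RangingNetwork

/-! ### From a quadratic inequality to the pseudo-inverse bound. -/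

/-- The covariance inequality in matrix form, with a possibly singular information matrix. -/
theorem posSemidef_sub_of_quadratic {ι r : Type*} [Fintype ι] [Fintype r]
    {S F : Matrix ι ι ℝ} {A : Matrix ι r ℝ} (hS : Sᵀ = S) (hF : Fᵀ = F)
    (h : ∀ (w : ι → ℝ) (c : r → ℝ),
      0 ≤ w ⬝ᵥ S *ᵥ w - 2 * (w ⬝ᵥ A *ᵥ c) + A *ᵥ c ⬝ᵥ F *ᵥ (A *ᵥ c)) :
    (S - A * pseudoInverse (Aᵀ * F * A) * Aᵀ).PosSemidef := by
  set M := Aᵀ * F * A with hM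
  have hMt : Mᵀ = M := by
    simp [hM, Matrix.transpose_mul, hF, Matrix.mul_assoc]
  have hP := pseudoInverse_spec M
  set P := pseudoInverse M
  -- As `M` is symmetric, `Pᵀ` satisfies the Penrose equations of `M` too, and uniqueness applies.
  have hPt : Pᵀ = P := by
    refine IsMoorePenrose.unique (M := M) ⟨?_, ?_, ?_, ?_⟩ hP
    · simpa [Matrix.transpose_mul, hMt, Matrix.mul_assoc] using
        congrArg Matrix.transpose hP.mul_mul_self
    · simpa [Matrix.transpose_mul, hMt, Matrix.mul_assoc] using
        congrArg Matrix.transpose hP.mul_mul_inv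
    · rw [Matrix.transpose_mul, Matrix.transpose_transpose, hMt, ← hP.symm_right,
        Matrix.transpose_mul, hMt]
    · rw [Matrix.transpose_mul, Matrix.transpose_transpose, hMt, ← hP.symm_left,
        Matrix.transpose_mul, hMt]
  refine Matrix.PosSemidef.of_dotProduct_mulVec_nonneg ?_ fun w => ?_
  · rw [Matrix.IsHermitian, Matrix.conjTranspose_eq_transpose_of_trivial]
    simp [Matrix.transpose_mul, hS, hPt, Matrix.mul_assoc]
  -- This `c` is a critical point of the quadratic in `c`. By `P M P = P` the quadratic term equals
  -- half the cross term in absolute value.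
  · have hq := h w ((P * Aᵀ) *ᵥ w)
    have e1 : A *ᵥ ((P * Aᵀ) *ᵥ w) = (A * P * Aᵀ) *ᵥ w := by
      rw [Matrix.mulVec_mulVec, Matrix.mul_assoc]
    have e2 : A *ᵥ ((P * Aᵀ) *ᵥ w) ⬝ᵥ F *ᵥ (A *ᵥ ((P * Aᵀ) *ᵥ w)) =
        w ⬝ᵥ (A * P * Aᵀ) *ᵥ w := by
      have hB : (A * P * Aᵀ)ᵀ * (F * (A * P * Aᵀ)) = A * P * Aᵀ := by
        calc (A * P * Aᵀ)ᵀ * (F * (A * P * Aᵀ)) = A * (P * M * P) * Aᵀ := by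
              simp [Matrix.transpose_mul, hPt, hM, Matrix.mul_assoc]
          _ = A * P * Aᵀ := by rw [hP.mul_mul_inv]
      rw [e1, ← Matrix.vecMul_transpose, ← Matrix.dotProduct_mulVec, Matrix.vecMul_transpose,
        Matrix.mulVec_mulVec, Matrix.mulVec_mulVec, Matrix.mul_assoc, hB]
    rw [e2, e1] at hq
    rw [star_trivial, Matrix.sub_mulVec, dotProduct_sub]
    linarith

/-! ### Tag displacements: information and unbiasedness along the constraint set. -/

namespace RangingNetwork

variable {U K : Type*} {n : ℕ}

/-- The linear embedding of tag displacements into displacements of all nodes. -/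
def tagEmbedding : (U × Fin n → ℝ) →ₗ[ℝ] ((U ⊕ K) × Fin n → ℝ) where
  toFun w := joinPos w 0
  map_add' w w' := by
    ext ⟨i, a⟩; cases i <;> simp [joinPos]
  map_smul' c w := by
    ext ⟨i, a⟩; cases i <;> simp [joinPos]

theorem joinPos_eq_add (q : U × Fin n → ℝ) (pK : K × Fin n → ℝ) :
    joinPos q pK = tagEmbedding q + joinPos 0 pK := by
  ext ⟨i, a⟩; cases i <;> simp [joinPos, tagEmbedding]

theorem tagEmbedding_single [DecidableEq U] [DecidableEq K] (i : U × Fin n) :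
    tagEmbedding (K := K) (Pi.single i 1) = Pi.single (Sum.inl i.1, i.2) 1 := by
  ext ⟨k, a⟩
  cases k <;> simp [tagEmbedding, joinPos, Pi.single_apply, Prod.ext_iff]

variable [Fintype U] [Fintype K]

/-- The derivative of the location parameters with respect to the tag positions. -/
noncomputable def tagJacobian (model : NoiseModel) (G : SimpleGraph (U ⊕ K))
    (p : (U ⊕ K) × Fin n → ℝ) : (U × Fin n → ℝ) →L[ℝ] (RangingPair G → ℝ) :=
  ContinuousLinearMap.pi fun e => (fderiv ℝ (pairLocation model (e : Sym2 (U ⊕ K))) p).comp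
    (LinearMap.toContinuousLinearMap tagEmbedding)

theorem hasFDerivAt_rangeLocation_joinPos (model : NoiseModel) (G : SimpleGraph (U ⊕ K))
    (pU : U × Fin n → ℝ) (pK : K × Fin n → ℝ)
    (hp : ∀ e : RangingPair G, pairDist (joinPos pU pK) e ≠ 0) :
    HasFDerivAt (fun q => rangeLocation model G (joinPos q pK))
      (tagJacobian model G (joinPos pU pK)) pU := by
  refine hasFDerivAt_pi.mpr fun e => ?_
  have h1 : HasFDerivAt (fun q : U × Fin n → ℝ => joinPos q pK)
      (LinearMap.toContinuousLinearMap (tagEmbedding (K := K))) pU := by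
    rw [funext fun q : U × Fin n → ℝ => joinPos_eq_add q pK]
    exact (LinearMap.toContinuousLinearMap (tagEmbedding (U := U) (K := K))).hasFDerivAt.add_const _
  exact ((contDiffAt_pairLocation model (hp e)).differentiableAt
    (by simp)).hasFDerivAt.comp pU h1

theorem eventually_pairDist_joinPos_ne_zero (G : SimpleGraph (U ⊕ K))
    (pU : U × Fin n → ℝ) (pK : K × Fin n → ℝ)
    (hp : ∀ e : RangingPair G, pairDist (joinPos pU pK) e ≠ 0) :
    ∀ᶠ q in 𝓝 pU, ∀ e : RangingPair G, pairDist (joinPos q pK) e ≠ 0 := by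
  refine Filter.eventually_all.mpr fun e => ?_
  -- The additive location is the distance itself, so its differentiability supplies the continuity.
  exact (hasFDerivAt_pi.mp (hasFDerivAt_rangeLocation_joinPos .additive G pU pK hp)
    e).continuousAt.eventually_ne (hp e)

theorem info_tagJacobian [DecidableEq U] [DecidableEq K] (model : NoiseModel) {σ : ℝ≥0}
    (hσ : 0 < σ) (G : SimpleGraph (U ⊕ K)) {p : (U ⊕ K) × Fin n → ℝ}
    (hp : ∀ e : RangingPair G, pairDist p e ≠ 0) (w : U × Fin n → ℝ) :
    GaussianLocation.info (σ ^ 2) (tagJacobian model G p w) =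
      w ⬝ᵥ tagFIM model σ G p *ᵥ w := by
  have hJ : ∀ e, tagJacobian model G p w e = ∑ i, w i *
      fderiv ℝ (pairLocation model (e : Sym2 (U ⊕ K))) p (Pi.single (Sum.inl i.1, i.2) 1) := by
    intro e
    have h := LinearMap.pi_apply_eq_sum_univ
      ((fderiv ℝ (pairLocation model (e : Sym2 (U ⊕ K))) p).toLinearMap.comp tagEmbedding) w
    refine Eq.trans h (Finset.sum_congr rfl fun i _ => ?_)
    rw [← tagEmbedding_single, smul_eq_mul]
    have hs : (fun j => if i = j then (1 : ℝ) else 0) = Pi.single i 1 := by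
      ext j
      simp [Pi.single_apply, eq_comm]
    rw [hs]
    rfl
  simp only [GaussianLocation.info, dotProduct, Matrix.mulVec, tagFIM_apply model hσ G hp,
    Finset.sum_mul, Finset.mul_sum]
  conv_rhs => enter [2, i]; rw [Finset.sum_comm]
  rw [Finset.sum_comm]
  refine Finset.sum_congr rfl fun e _ => ?_
  rw [hJ, sq, Finset.sum_mul_sum, Finset.sum_div]
  refine Finset.sum_congr rfl fun i _ => ?_
  rw [Finset.sum_div]
  refine Finset.sum_congr rfl fun j _ => ?_
  push_cast
  ring

/-- Differentiating the unbiasedness condition along the tangent directions. -/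
theorem meanDeriv_tagJacobian {C : Type*} (model : NoiseModel) {σ : ℝ≥0} (hσ : 0 < σ)
    (G : SimpleGraph (U ⊕ K)) {fc : (U × Fin n → ℝ) → (C → ℝ)}
    {pU : U × Fin n → ℝ} {pK : K × Fin n → ℝ}
    (hp : ∀ e : RangingPair G, pairDist (joinPos pU pK) e ≠ 0) (hfeas : fc pU = 0)
    {est : (RangingPair G → ℝ) → (U × Fin n → ℝ)}
    (hunbiased : IsUnbiasedNear model σ G pK fc est pU) (i : U × Fin n)
    (hX : MemLp (fun z => est (fun e => model.link (z e)) i) 2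
      (GaussianLocation.law (σ ^ 2) (rangeLocation model G (joinPos pU pK))))
    {v : U × Fin n → ℝ} (hv : v ∈ Submodule.span ℝ (tangentConeAt ℝ (feasibleTags fc) pU)) :
    GaussianLocation.meanDeriv (σ ^ 2) (rangeLocation model G (joinPos pU pK))
      (fun z => est (fun e => model.link (z e)) i) (tagJacobian model G (joinPos pU pK) v) =
      v i := by
  have hD := ((GaussianLocation.hasFDerivAt_integral (pow_pos hσ 2).ne' hX).comp pU
    (hasFDerivAt_rangeLocation_joinPos model G pU pK hp)).hasFDerivWithinAt
    (s := feasibleTags fc)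
  have heq : (fun q => ∫ z, est (fun e => model.link (z e)) i
      ∂(GaussianLocation.law (σ ^ 2) (rangeLocation model G (joinPos q pK))))
      =ᶠ[𝓝[feasibleTags fc] pU] fun q => q i := by
    filter_upwards [hunbiased, nhdsWithin_le_nhds (eventually_pairDist_joinPos_ne_zero G pU pK hp)]
      with q hq hd
    obtain ⟨hint, hmean⟩ := hq i
    rw [rangeLaw_eq_map model σ G hd] at hint hmean
    rw [← hmean, integral_map (measurable_link_pi model G).aemeasurable hint.aestronglyMeasurable]
  have hE := ((hasFDerivAt_apply (𝕜 := ℝ) i pU).hasFDerivWithinAt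
    (s := feasibleTags fc)).congr_of_eventuallyEq heq (heq.self_of_nhdsWithin hfeas)
  -- Derivatives within a set are unique only on its tangent cone; linearity extends the equality to
  -- the span.
  exact LinearMap.eqOn_span (f := (ContinuousLinearMap.toLinearMap _))
    (g := (ContinuousLinearMap.toLinearMap _)) (hD.unique_on hE) hv

end RangingNetwork

/-! ### The constrained Cramér–Rao bound. -/

theorem mainTheorem3
    {U K : Type*} [Fintype U] [DecidableEq U] [Fintype K] [DecidableEq K] {n : ℕ}
    {C : Type*} [Fintype C] {r : Type*} [Fintype r]
    (model : RangingNetwork.NoiseModel) (σ : ℝ≥0) (hσ : 0 < σ)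
    (G : SimpleGraph (U ⊕ K))
    (fc : (U × Fin n → ℝ) → (C → ℝ))
    (pU : U × Fin n → ℝ) (pK : K × Fin n → ℝ)
    (hdist : ∀ e : RangingNetwork.RangingPair G,
      RangingNetwork.pairDist (RangingNetwork.joinPos pU pK) e ≠ 0)
    (hfeas : fc pU = 0) (hdiff : DifferentiableAt ℝ fc pU)
    (hreg : LinearMap.ker (jacobianMatrix fc pU).mulVecLin ≤
      Submodule.span ℝ (tangentConeAt ℝ (RangingNetwork.feasibleTags fc) pU))
    (A : Matrix (U × Fin n) r ℝ)
    (hA : Submodule.span ℝ (Set.range A.col) = LinearMap.ker (jacobianMatrix fc pU).mulVecLin)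
    (est : (RangingNetwork.RangingPair G → ℝ) → (U × Fin n → ℝ))
    (hunbiased : RangingNetwork.IsUnbiasedNear model σ G pK fc est pU)
    (hfinite : ∀ i, MemLp (fun y => est y i) 2
      (RangingNetwork.rangeLaw model σ G (RangingNetwork.joinPos pU pK))) :
    RangingNetwork.tagFIM model σ G (RangingNetwork.joinPos pU pK) =
      RangingNetwork.tagBlock
        (RangingNetwork.explicitFIM model σ G (RangingNetwork.joinPos pU pK)) ∧
    (covMatrix est (RangingNetwork.rangeLaw model σ G (RangingNetwork.joinPos pU pK)) -
      RangingNetwork.constrainedBound model σ G (RangingNetwork.joinPos pU pK) A).PosSemidef := by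
  refine ⟨RangingNetwork.tagFIM_eq_tagBlock_explicitFIM model hσ G hdist, ?_⟩
  set m := RangingNetwork.rangeLocation model G (RangingNetwork.joinPos pU pK) with hm
  set J := RangingNetwork.tagJacobian model G (RangingNetwork.joinPos pU pK)
  set X : U × Fin n → (RangingNetwork.RangingPair G → ℝ) → ℝ :=
    fun i z => est (fun e => model.link (z e)) i with hXdef
  have hlink := (RangingNetwork.measurable_link_pi model G).aemeasurable
    (μ := GaussianLocation.law (σ ^ 2) m)
  have hmap := RangingNetwork.rangeLaw_eq_map model σ G hdist
  have hX : ∀ i, MemLp (X i) 2 (GaussianLocation.law (σ ^ 2) m) := fun i => by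
    have h := hfinite i
    rw [hmap] at h
    exact h.comp_of_map hlink
  have hcov : covMatrix est (RangingNetwork.rangeLaw model σ G (RangingNetwork.joinPos pU pK)) =
      Matrix.of fun i j => cov[X i, X j; GaussianLocation.law (σ ^ 2) m] := by
    ext i j
    rw [covMatrix, Matrix.of_apply, Matrix.of_apply]
    have hi := (hfinite i).aestronglyMeasurable
    have hj := (hfinite j).aestronglyMeasurable
    rw [hmap] at hi hj ⊢
    exact covariance_map_fun hi hj hlink
  rw [hcov, RangingNetwork.constrainedBound]
  refine posSemidef_sub_of_quadratic ?_ ?_ fun w c => ?_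
  · ext i j
    exact covariance_comm _ _
  · ext i j
    simp only [Matrix.transpose_apply, RangingNetwork.tagFIM_apply model hσ G hdist]
    exact Finset.sum_congr rfl fun e _ => by ring
  · have hv : σ ^ 2 ≠ 0 := (pow_pos hσ 2).ne'
    have hker : A *ᵥ c ∈ LinearMap.ker (jacobianMatrix fc pU).mulVecLin := by
      rw [← hA, ← Matrix.range_mulVecLin]
      exact ⟨c, rfl⟩
    have hY := GaussianLocation.memLp_score (v := σ ^ 2) m m (J (A *ᵥ c))
    have hW : ∀ i ∈ Finset.univ, MemLp (fun z => w i * X i z) 2 (GaussianLocation.law (σ ^ 2) m) :=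
      fun i _ => (hX i).const_mul _
    have hWsum := memLp_finsetSum Finset.univ hW
    have h1 : Var[fun z => ∑ i, w i * X i z; GaussianLocation.law (σ ^ 2) m] =
        w ⬝ᵥ (Matrix.of fun i j => cov[X i, X j; GaussianLocation.law (σ ^ 2) m]) *ᵥ w := by
      rw [← covariance_self hWsum.aestronglyMeasurable.aemeasurable,
        covariance_fun_sum_fun_sum' hW hW]
      simp only [covariance_const_mul_left, covariance_const_mul_right, dotProduct, Matrix.mulVec,
        Matrix.of_apply, Finset.mul_sum]
      exact Finset.sum_congr rfl fun i _ => Finset.sum_congr rfl fun j _ => by ring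
    have h2 : cov[fun z => ∑ i, w i * X i z, GaussianLocation.score (σ ^ 2) m (J (A *ᵥ c));
        GaussianLocation.law (σ ^ 2) m] = w ⬝ᵥ A *ᵥ c := by
      rw [covariance_fun_sum_left' hW hY]
      refine Finset.sum_congr rfl fun i _ => ?_
      rw [covariance_const_mul_left, covariance_eq_sub (hX i) hY,
        GaussianLocation.integral_score_self, mul_zero, sub_zero]
      congr 1
      exact (GaussianLocation.meanDeriv_apply (hX i) _).symm.trans
        (RangingNetwork.meanDeriv_tagJacobian model hσ G hdist hfeas hunbiased i (hX i)
          (hreg hker))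
    -- Expanding this variance yields the quadratic inequality for `w` and `c`.
    have h3 := variance_nonneg (fun z => (∑ i, w i * X i z) -
      GaussianLocation.score (σ ^ 2) m (J (A *ᵥ c)) z) (GaussianLocation.law (σ ^ 2) m)
    rw [variance_fun_sub hWsum hY, h1, h2, GaussianLocation.variance_score hv,
      RangingNetwork.info_tagJacobian model hσ G hdist] at h3
    exact h3
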